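/- Let $0<q<1$ and $\nu>-1$ be real. For $n\in\mathbb{N}$ put $(a;q)_n=\prod_{i=0}^{n-1}(1-aq^i)$ and $(a;q)_\infty=\lim_{n\to\infty}(a;q)_n$, and let $$J_\nu(z;q)=z^\nu\,\frac{(q^{\nu+1};q)_\infty}{(q;q)_\infty}\sum_{k=0}^{\infty}(-1)^k\frac{q^{k(k+1)/2}}{(q^{\nu+1};q)_k\,(q;q)_k}\,z^{2k}\qquad(z>0)$$ be the third Jackson (Hahn–Exton) $q$-Bessel function; $J_\nu(z;q^2)$ denotes the same function with $q$ replaced by $q^2$. Let $(\theta_m)_{m\ge1}$ be a sequence of real numbers with $0\le\theta_m<1$ for all $m\ge1$. (i) If $\lim_{m\to\infty}m\theta_m=0$, then for all sufficiently large $m$ $$\operatorname{sgn}\left(\left.\frac{\partial J_\nu(z;q^2)}{\partial z}\right|_{z=q^{-m+\theta_m}}\right)=(-1)^m .$$ (ii) If $\lim_{m\to\infty}m\theta_m=\infty$, then for all sufficiently large $m$ $$\operatorname{sgn}\left(\left.\frac{\partial J_\nu(z;q^2)}{\partial z}\right|_{z=q^{-m+\theta_m}}\right)=(-1)^{m-1}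 .$$ -/

import Mathlib

open Filter Topology

/-- The finite shifted factorial `(a; q)_n = (1 - a) (1 - a q) ⋯ (1 - a q ^ (n - 1))`. -/
noncomputable def qShifted (a q : ℝ) (n : ℕ) : ℝ :=
  ∏ i ∈ Finset.range n, (1 - a * q ^ i)

/-- The infinite shifted factorial `(a; q)_∞ = ∏_{i ≥ 0} (1 - a q ^ i)`. -/
noncomputable def qShiftedInf (a q : ℝ) : ℝ :=
  ∏' i : ℕ, (1 - a * q ^ i)

/-- For `0 < q < 1`, `(a; q)_∞` is the limit of `(a; q)_n` as `n → ∞`. -/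
theorem tendsto_qShifted (a q : ℝ) (hq0 : 0 < q) (hq1 : q < 1) :
    Tendsto (fun n : ℕ => qShifted a q n) atTop (𝓝 (qShiftedInf a q)) := by
  have hs : Summable (fun i : ℕ => ‖-(a * q ^ i)‖) :=
    ((summable_geometric_of_lt_one hq0.le hq1).mul_left a).neg.norm
  have hm : Multipliable (fun i : ℕ => 1 - a * q ^ i) := by
    simpa [sub_eq_add_neg] using multipliable_one_add_of_summable hs
  exact hm.hasProd.tendsto_prod_nat

/-- The third Jackson (Hahn-Exton) `q`-Bessel function
`J_ν(z; q) = z^ν (q^(ν+1); q)_∞ / (q; q)_∞ *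
  ∑_{k ≥ 0} (-1)^k q^(k(k+1)/2) / ((q^(ν+1); q)_k (q; q)_k) z^(2k)`
for a real order `ν > -1`, a base `0 < q < 1` and a positive real argument `z`. -/
noncomputable def hahnExtonJ (ν q z : ℝ) : ℝ :=
  z ^ ν * (qShiftedInf (q ^ (ν + 1)) q / qShiftedInf q q) *
    ∑' k : ℕ, (-1) ^ k *
      (q ^ (k * (k + 1) / 2) / (qShifted (q ^ (ν + 1)) q k * qShifted q q k)) * z ^ (2 * k)

/-!
The derivative of `J_ν(z; q^2)` at `z = q^(-m+t)`, with `0 ≤ t ≤ 1`, is a power series in which the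
factor `q^(k(k+1) - 2mk)` concentrates the mass at indices `k` near `m`. Writing `k = m + j` and
taking out a positive factor and `(-1)^m` leaves (`tsum_eq_centredSum`)
`∑_j (ν + 2m + 2j) w_(m+j) (-1)^j q^(j(j+1) + 2tj)`, where
`w_k = 1 / ((q^(2ν+2); q^2)_k (q^2; q^2)_k)`. Since `w_k` converges to a positive limit `w_∞` at the
rate `q^(2k)`, the sum differs by `O(m q^(2m))`, uniformly in `t`, from
`w_∞ ((2m + ν) F(t) + 2 G(t))`, where `F(t) = ∑_j (-1)^j q^(j(j+1) + 2tj)` is `theta` and `G`, its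
first moment, is `thetaMoment` (`exists_abs_centredSum_sub_le`).

By the Jacobi triple product, with `p = q^2` and `x = p^t`,
`F(t) = (p; p)_∞ ∏_{k ≥ 0} (1 - p^(k+1) x) (1 - p^k / x)`. On `[0, 1]` only the factors `1 - 1/x` and
`1 - p/x` can vanish, so `F(0) = F(1) = 0` and `F(t) ≤ -c t (1 - t)` with `c > 0`
(`exists_theta_le`). As `F' = 2 log q · G` and `log q < 0`, this gives `G(0) > 0 > G(1)`. If
`m θ_m → 0`, then `(2m + ν) F(θ_m) → 0` and `G(0) > 0` decides the sign. If `m θ_m → ∞`, the term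
`(2m + ν) F(θ_m)` tends to `-∞` as long as `θ_m` stays away from `1`, while near `1` both
`F(θ_m) ≤ 0` and `G(θ_m) < 0`.

The triple product is obtained in its finite form (`hasSum_tripleProd`) by induction on the number
of factors, comparing coefficients, followed by dominated convergence.
-/

namespace HahnExton

/-! ### Shifted factorials -/

lemma one_sub_mul_pow_pos {a p : ℝ} (ha0 : 0 ≤ a) (ha1 : a < 1) (hp0 : 0 < p) (hp1 : p < 1)
    (i : ℕ) : 0 < 1 - a * p ^ i := by
  have := mul_le_of_le_one_right ha0 (pow_le_one₀ hp0.le hp1.le (n := i))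
  linarith

lemma qShifted_pos {a p : ℝ} (ha0 : 0 ≤ a) (ha1 : a < 1) (hp0 : 0 < p) (hp1 : p < 1) (n : ℕ) :
    0 < qShifted a p n :=
  Finset.prod_pos fun i _ => one_sub_mul_pow_pos ha0 ha1 hp0 hp1 i

lemma qShifted_succ (a p : ℝ) (n : ℕ) :
    qShifted a p (n + 1) = qShifted a p n * (1 - a * p ^ n) :=
  Finset.prod_range_succ _ _

lemma qShiftedInf_pos {a p : ℝ} (ha0 : 0 ≤ a) (ha1 : a < 1) (hp0 : 0 < p) (hp1 : p < 1) :
    0 < qShiftedInf a p := by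
  have hs : Summable (fun i : ℕ => ‖-(a * p ^ i)‖) :=
    ((summable_geometric_of_lt_one hp0.le hp1).mul_left a).neg.norm
  have hne : qShiftedInf a p ≠ 0 := by
    have := tprod_one_add_ne_zero_of_summable (f := fun i : ℕ => -(a * p ^ i))
      (fun i => by
        have := one_sub_mul_pow_pos ha0 ha1 hp0 hp1 i
        rw [← sub_eq_add_neg]; exact this.ne') hs
    simpa [qShiftedInf, sub_eq_add_neg] using this
  exact lt_of_le_of_ne (ge_of_tendsto' (tendsto_qShifted a p hp0 hp1)
    fun n => (qShifted_pos ha0 ha1 hp0 hp1 n).le) hne.symm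

lemma qShiftedInf_le_qShifted {a p : ℝ} (ha0 : 0 ≤ a) (ha1 : a < 1) (hp0 : 0 < p) (hp1 : p < 1)
    (n : ℕ) : qShiftedInf a p ≤ qShifted a p n := by
  refine Antitone.le_of_tendsto (antitone_nat_of_succ_le fun k => ?_)
    (tendsto_qShifted a p hp0 hp1) n
  rw [qShifted_succ]
  refine mul_le_of_le_one_right (qShifted_pos ha0 ha1 hp0 hp1 k).le ?_
  have : 0 ≤ a * p ^ k := by positivity
  linarith

/-- The weight `1 / ((a; p)_k (p; p)_k)` occurring in the power series of `J_ν`. -/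
noncomputable def weight (a p : ℝ) (k : ℕ) : ℝ := 1 / (qShifted a p k * qShifted p p k)

/-- The limit `1 / ((a; p)_∞ (p; p)_∞)` of the weights. -/
noncomputable def weightInf (a p : ℝ) : ℝ := 1 / (qShiftedInf a p * qShiftedInf p p)

section
variable {a p : ℝ} (ha0 : 0 ≤ a) (ha1 : a < 1) (hp0 : 0 < p) (hp1 : p < 1)
include ha0 ha1 hp0 hp1

lemma weight_pos (k : ℕ) : 0 < weight a p k := by
  have h1 := qShifted_pos ha0 ha1 hp0 hp1 k
  have h2 := qShifted_pos hp0.le hp1 hp0 hp1 k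
  unfold weight; positivity

lemma weightInf_pos : 0 < weightInf a p := by
  have h1 := qShiftedInf_pos ha0 ha1 hp0 hp1
  have h2 := qShiftedInf_pos hp0.le hp1 hp0 hp1
  unfold weightInf; positivity

lemma weight_le_weightInf (k : ℕ) : weight a p k ≤ weightInf a p := by
  have h1 := qShiftedInf_pos ha0 ha1 hp0 hp1
  have h2 := qShiftedInf_pos hp0.le hp1 hp0 hp1
  exact one_div_le_one_div_of_le (by positivity)
    (mul_le_mul (qShiftedInf_le_qShifted ha0 ha1 hp0 hp1 k)
      (qShiftedInf_le_qShifted hp0.le hp1 hp0 hp1 k) h2.le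
      (qShifted_pos ha0 ha1 hp0 hp1 k).le)

lemma tendsto_weight : Tendsto (weight a p) atTop (𝓝 (weightInf a p)) := by
  have h1 := qShiftedInf_pos ha0 ha1 hp0 hp1
  have h2 := qShiftedInf_pos hp0.le hp1 hp0 hp1
  exact tendsto_const_nhds.div ((tendsto_qShifted a p hp0 hp1).mul
    (tendsto_qShifted p p hp0 hp1)) (by positivity)

/-- The weights converge geometrically fast: consecutive ones differ by `O(p ^ k)`. -/
lemma abs_weight_sub_weightInf_le (k : ℕ) :
    |weight a p k - weightInf a p| ≤ 2 * weightInf a p * p ^ k / (1 - p) := by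
  refine dist_le_of_le_geometric_of_tendsto p (2 * weightInf a p) hp1 (fun n => ?_)
    (tendsto_weight ha0 ha1 hp0 hp1) k
  have h1 := one_sub_mul_pow_pos ha0 ha1 hp0 hp1 n
  have h2 := one_sub_mul_pow_pos hp0.le hp1 hp0 hp1 n
  have hr : weight a p n = weight a p (n + 1) * ((1 - a * p ^ n) * (1 - p * p ^ n)) := by
    have h3 := (qShifted_pos ha0 ha1 hp0 hp1 n).ne'
    have h4 := (qShifted_pos hp0.le hp1 hp0 hp1 n).ne'
    have h5 := h1.ne'
    have h6 : 1 - p ^ n * p ≠ 0 := by rw [mul_comm]; exact h2.ne'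
    simp only [weight, qShifted_succ, mul_comm p (p ^ n)]
    field_simp
  have hpn : 0 < p ^ n := by positivity
  have hle := weight_le_weightInf ha0 ha1 hp0 hp1 (n + 1)
  have hpos := weight_pos ha0 ha1 hp0 hp1 (n + 1)
  have ha : 0 ≤ a * p ^ n := by positivity
  have hp : 0 ≤ p * p ^ n := by positivity
  have ha' : a * p ^ n ≤ p ^ n := mul_le_of_le_one_left hpn.le ha1.le
  have hp' : p * p ^ n ≤ p ^ n := mul_le_of_le_one_left hpn.le hp1.le
  have hd : weight a p (n + 1) - weight a p n
      = weight a p (n + 1) * (1 - (1 - a * p ^ n) * (1 - p * p ^ n)) := by rw [hr]; ring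
  rw [dist_comm, Real.dist_eq, hd, abs_of_nonneg (mul_nonneg hpos.le (by nlinarith))]
  calc _ ≤ weightInf a p * (2 * p ^ n) := by
        refine mul_le_mul hle (by nlinarith) (by nlinarith) (hpos.le.trans hle)
    _ = _ := by ring

end

/-- `1 / (p; p)_k` extended by `0` to negative integers `k`. -/
noncomputable def recipShifted (p : ℝ) (k : ℤ) : ℝ :=
  if 0 ≤ k then 1 / qShifted p p k.toNat else 0

/-- With the value `0` at negative integers, the recurrence holds on all of `ℤ`:
at `k = 0` the factor `1 - p ^ k` vanishes. -/
lemma recipShifted_sub_one {p : ℝ} (hp0 : 0 < p) (hp1 : p < 1) (k : ℤ) :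
    recipShifted p (k - 1) = (1 - p ^ k) * recipShifted p k := by
  rcases lt_trichotomy k 0 with hk | rfl | hk
  · rw [recipShifted, recipShifted, if_neg (by lia), if_neg (by lia), mul_zero]
  · simp [recipShifted]
  · obtain ⟨n, rfl⟩ : ∃ n : ℕ, k = n + 1 := ⟨(k - 1).toNat, by lia⟩
    have h1 := (qShifted_pos hp0.le hp1 hp0 hp1 n).ne'
    have h2 := (one_sub_mul_pow_pos hp0.le hp1 hp0 hp1 n).ne'
    have h3 : ((n : ℤ) + 1).toNat = n + 1 := by lia
    simp only [recipShifted, add_sub_cancel_right, Int.natCast_nonneg, if_true, Int.toNat_natCast,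
      show (0 : ℤ) ≤ n + 1 by lia, h3, qShifted_succ]
    rw [zpow_add_one₀ hp0.ne', zpow_natCast, mul_comm (p ^ n) p]
    field_simp

lemma recipShifted_nonneg {p : ℝ} (hp0 : 0 < p) (hp1 : p < 1) (k : ℤ) :
    0 ≤ recipShifted p k := by
  unfold recipShifted
  split_ifs
  · exact (one_div_pos.2 (qShifted_pos hp0.le hp1 hp0 hp1 _)).le
  · rfl

lemma recipShifted_le {p : ℝ} (hp0 : 0 < p) (hp1 : p < 1) (k : ℤ) :
    recipShifted p k ≤ 1 / qShiftedInf p p := by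
  have h := qShiftedInf_pos hp0.le hp1 hp0 hp1
  unfold recipShifted
  split_ifs
  · exact one_div_le_one_div_of_le h (qShiftedInf_le_qShifted hp0.le hp1 hp0 hp1 _)
  · positivity

lemma tendsto_recipShifted {p : ℝ} (hp0 : 0 < p) (hp1 : p < 1) :
    Tendsto (recipShifted p) atTop (𝓝 (1 / qShiftedInf p p)) := by
  have h := qShiftedInf_pos hp0.le hp1 hp0 hp1
  have h1 : Tendsto (fun k : ℤ => 1 / qShifted p p k.toNat) atTop (𝓝 (1 / qShiftedInf p p)) :=
    tendsto_const_nhds.div ((tendsto_qShifted p p hp0 hp1).comp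
      (tendsto_atTop.2 fun n => by
        filter_upwards [eventually_ge_atTop (n : ℤ)] with k hk; lia)) h.ne'
  refine h1.congr' ?_
  filter_upwards [eventually_ge_atTop 0] with k hk
  simp [recipShifted, hk]

/-! ### The alternating theta series -/

/-- The term `(-1)^j q^(j(j+1)) x^j` with `x = q^(2t)` of the theta series. -/
noncomputable def thetaTerm (q t : ℝ) (j : ℤ) : ℝ :=
  (-1) ^ j * q ^ ((j : ℝ) * (j + 1) + 2 * t * j)

/-- The theta series `∑_{j ∈ ℤ} (-1)^j q^(j(j+1)) x^j` with `x = q^(2t)`. -/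
noncomputable def theta (q t : ℝ) : ℝ := ∑' j : ℤ, thetaTerm q t j

/-- The first moment `∑_{j ∈ ℤ} j (-1)^j q^(j(j+1)) x^j` with `x = q^(2t)`. -/
noncomputable def thetaMoment (q t : ℝ) : ℝ := ∑' j : ℤ, (j : ℝ) * thetaTerm q t j

/-- A summable majorant for theta terms and their first moments, uniform for `t ∈ [-1, 2]`.
The constant `5` bounds both `|1 + 2t|` on `[-1, 2]` and `3 + 2t` on `[0, 1]`; the latter occurs when
a theta term is multiplied by the error `q^(2j)` of a weight. -/
noncomputable def thetaBound (q : ℝ) (j : ℤ) : ℝ :=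
  (1 + |(j : ℝ)|) * q ^ ((j : ℝ) ^ 2 - 5 * |(j : ℝ)|)

section
variable {q : ℝ} (hq0 : 0 < q) (hq1 : q < 1)
include hq0

lemma abs_thetaTerm (t : ℝ) (j : ℤ) :
    |thetaTerm q t j| = q ^ ((j : ℝ) * (j + 1) + 2 * t * j) := by
  rw [thetaTerm, abs_mul, abs_neg_one_zpow, one_mul, abs_of_pos (Real.rpow_pos_of_pos hq0 _)]

lemma hasDerivAt_thetaTerm (t : ℝ) (j : ℤ) :
    HasDerivAt (fun s => thetaTerm q s j) (2 * Real.log q * (j * thetaTerm q t j)) t := by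
  have h1 : HasDerivAt (fun s : ℝ => (j : ℝ) * (j + 1) + 2 * s * j) (2 * 1 * j) t :=
    (((hasDerivAt_id t).const_mul 2).mul_const (j : ℝ)).const_add _
  refine ((h1.const_rpow hq0).const_mul ((-1 : ℝ) ^ j)).congr_deriv ?_
  simp only [thetaTerm]
  ring

include hq1

lemma summable_one_add_abs_mul_rpow (c : ℝ) :
    Summable fun j : ℤ => (1 + |(j : ℝ)|) * q ^ ((j : ℝ) ^ 2 - c * |(j : ℝ)|) := by
  have hL : Real.log q < 0 := Real.log_neg hq0 hq1
  have hT : 0 < -Real.log q / Real.pi := div_pos (by linarith) Real.pi_pos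
  have h := fun k => summable_pow_mul_jacobiTheta₂_term_bound
    (-c * Real.log q / (2 * Real.pi)) hT k
  refine ((h 0).add (h 1)).congr fun j => ?_
  have e : -Real.pi * (-Real.log q / Real.pi * (j : ℝ) ^ 2
      - 2 * (-c * Real.log q / (2 * Real.pi)) * |(j : ℝ)|)
      = Real.log q * ((j : ℝ) ^ 2 - c * |(j : ℝ)|) := by
    field_simp
    ring
  rw [Real.rpow_def_of_pos hq0, Int.cast_abs, e]
  ring

lemma summable_thetaBound : Summable (thetaBound q) :=
  summable_one_add_abs_mul_rpow hq0 hq1 5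

lemma rpow_le_thetaBound {c : ℝ} (hc : |c| ≤ 5) (j : ℤ) :
    (1 + |(j : ℝ)|) * q ^ ((j : ℝ) ^ 2 + c * j) ≤ thetaBound q j := by
  refine mul_le_mul_of_nonneg_left (Real.rpow_le_rpow_of_exponent_ge hq0 hq1.le ?_) (by positivity)
  have h1 : |c * j| ≤ 5 * |(j : ℝ)| := by
    rw [abs_mul]; exact mul_le_mul_of_nonneg_right hc (abs_nonneg _)
  linarith [neg_abs_le (c * j)]

lemma one_add_abs_mul_thetaTerm_le {t : ℝ} (ht : t ∈ Set.Icc (-1) 2) (j : ℤ) :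
    (1 + |(j : ℝ)|) * |thetaTerm q t j| ≤ thetaBound q j := by
  rw [abs_thetaTerm hq0]
  have := rpow_le_thetaBound hq0 hq1 (c := 1 + 2 * t)
    (abs_le.2 ⟨by linarith [ht.1], by linarith [ht.2]⟩) j
  convert this using 3
  ring

lemma abs_thetaTerm_le {t : ℝ} (ht : t ∈ Set.Icc (-1) 2) (j : ℤ) :
    |thetaTerm q t j| ≤ thetaBound q j := by
  have := one_add_abs_mul_thetaTerm_le hq0 hq1 ht j
  nlinarith [abs_nonneg (j : ℝ), abs_nonneg (thetaTerm q t j)]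

lemma abs_mul_thetaTerm_le {t : ℝ} (ht : t ∈ Set.Icc (-1) 2) (j : ℤ) :
    |(j : ℝ) * thetaTerm q t j| ≤ thetaBound q j := by
  have := one_add_abs_mul_thetaTerm_le hq0 hq1 ht j
  rw [abs_mul]
  nlinarith [abs_nonneg (j : ℝ), abs_nonneg (thetaTerm q t j)]

lemma summable_thetaTerm {t : ℝ} (ht : t ∈ Set.Icc (-1) 2) : Summable (thetaTerm q t) :=
  (summable_thetaBound hq0 hq1).of_norm_bounded (abs_thetaTerm_le hq0 hq1 ht)

lemma summable_mul_thetaTerm {t : ℝ} (ht : t ∈ Set.Icc (-1) 2) :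
    Summable fun j : ℤ => (j : ℝ) * thetaTerm q t j :=
  (summable_thetaBound hq0 hq1).of_norm_bounded (abs_mul_thetaTerm_le hq0 hq1 ht)

lemma hasDerivAt_theta {t : ℝ} (ht : t ∈ Set.Ioo (-1) 2) :
    HasDerivAt (theta q) (2 * Real.log q * thetaMoment q t) t := by
  rw [thetaMoment, ← tsum_mul_left]
  refine hasDerivAt_tsum_of_isPreconnected
    ((summable_thetaBound hq0 hq1).mul_left |2 * Real.log q|) isOpen_Ioo isPreconnected_Ioo
    (fun j s _ => hasDerivAt_thetaTerm hq0 s j) (fun j s hs => ?_) ht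
    (summable_thetaTerm hq0 hq1 (Set.Ioo_subset_Icc_self ht)) ht
  rw [Real.norm_eq_abs, abs_mul]
  exact mul_le_mul_of_nonneg_left
    (abs_mul_thetaTerm_le hq0 hq1 (Set.Ioo_subset_Icc_self hs) j) (abs_nonneg _)

lemma continuousOn_thetaMoment : ContinuousOn (thetaMoment q) (Set.Icc (-1) 2) :=
  continuousOn_tsum (fun j => (continuous_const.mul (continuous_iff_continuousAt.2 fun t =>
    (hasDerivAt_thetaTerm hq0 t j).continuousAt)).continuousOn) (summable_thetaBound hq0 hq1)
    fun j _ ht => abs_mul_thetaTerm_le hq0 hq1 ht j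

end

/-! ### The Jacobi triple product -/

/-- The partial product `∏_{k < N} (1 - p^(k+1) x) (1 - p^k / x)` of the Jacobi triple product,
with `p = q^2` and `x = q^(2t)`. -/
noncomputable def tripleProd (q t : ℝ) (N : ℕ) : ℝ :=
  ∏ k ∈ Finset.range N, ((1 - (q ^ 2) ^ (k + 1) * q ^ (2 * t)) * (1 - (q ^ 2) ^ k / q ^ (2 * t)))

section
variable {q : ℝ} (hq0 : 0 < q)
include hq0

lemma thetaTerm_sub_one (t : ℝ) (j : ℤ) :
    thetaTerm q t (j - 1) * q ^ (2 * t) = -(thetaTerm q t j / (q ^ 2) ^ j) := by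
  have e : (q ^ 2) ^ j = q ^ (2 * (j : ℝ)) := by
    rw [Real.rpow_mul hq0.le, Real.rpow_intCast]; norm_cast
  rw [e, thetaTerm, thetaTerm, zpow_sub_one₀ (by norm_num), mul_assoc, ← Real.rpow_add hq0,
    mul_div_assoc, ← Real.rpow_sub hq0, mul_assoc, inv_neg_one, neg_one_mul, mul_neg]
  congr 3
  push_cast
  ring

lemma thetaTerm_add_one (t : ℝ) (j : ℤ) :
    thetaTerm q t (j + 1) / q ^ (2 * t) = -(thetaTerm q t j * (q ^ 2) ^ (j + 1)) := by
  have h := thetaTerm_sub_one hq0 t (j + 1)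
  have h1 : (q ^ 2) ^ (j + 1) ≠ 0 := (zpow_pos (by positivity) _).ne'
  have h2 : q ^ (2 * t) ≠ 0 := (Real.rpow_pos_of_pos hq0 _).ne'
  rw [add_sub_cancel_right] at h
  field_simp at h ⊢
  linarith

/-- The finite form of the Jacobi triple product (a symmetric `q`-binomial theorem). -/
lemma hasSum_tripleProd (hq1 : q < 1) (t : ℝ) (N : ℕ) :
    HasSum (fun j : ℤ => qShifted (q ^ 2) (q ^ 2) (2 * N) *
      (recipShifted (q ^ 2) (N + j) * recipShifted (q ^ 2) (N - j)) * thetaTerm q t j)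
      (tripleProd q t N) := by
  have hp0 : 0 < q ^ 2 := by positivity
  have hp1 : q ^ 2 < 1 := pow_lt_one₀ hq0.le hq1 two_ne_zero
  induction N with
  | zero =>
    convert hasSum_single (0 : ℤ) fun j hj => ?_ using 1
    · simp [tripleProd, recipShifted, thetaTerm, qShifted]
    · rcases lt_or_gt_of_ne hj with h | h
      · simp [recipShifted, h]
      · simp [recipShifted, h]
  | succ N ih =>
    have hl := (Equiv.subRight (1 : ℤ)).hasSum_iff.2 ih
    have hr := (Equiv.addRight (1 : ℤ)).hasSum_iff.2 ih
    have hx : q ^ (2 * t) ≠ 0 := (Real.rpow_pos_of_pos hq0 _).ne'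
    -- `P_(N+1) = P_N ((1 + p^(2N+1)) - p^(N+1) x - p^N / x)`, and multiplication of the series by
    -- `x` or `1 / x` shifts the index
    convert! (ih.mul_right (1 + (q ^ 2) ^ (2 * N + 1))).sub
      ((hl.mul_right ((q ^ 2) ^ (N + 1) * q ^ (2 * t))).add
        (hr.mul_right ((q ^ 2) ^ N / q ^ (2 * t)))) using 1
    · funext j
      have tl := thetaTerm_sub_one hq0 t j
      have tr := thetaTerm_add_one hq0 t j
      simp only [Function.comp_apply, Equiv.subRight_apply, Equiv.coe_addRight]
      have r1 := recipShifted_sub_one hp0 hp1 (N + 1 + j)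
      have r2 := recipShifted_sub_one hp0 hp1 (N + 1 - j)
      have r3 := recipShifted_sub_one hp0 hp1 (N + j)
      have r4 := recipShifted_sub_one hp0 hp1 (N - j)
      rw [show (N : ℤ) + 1 + j - 1 = N + j by ring] at r1
      rw [show (N : ℤ) + 1 - j - 1 = N - j by ring] at r2
      rw [r1] at r3
      rw [r2] at r4
      have e1 : (N : ℤ) + (j - 1) = N + j - 1 := by ring
      have e2 : (N : ℤ) - (j - 1) = N + 1 - j := by ring
      have e3 : (N : ℤ) + (j + 1) = N + 1 + j := by ring
      have e4 : (N : ℤ) - (j + 1) = N - j - 1 := by ring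
      have e5 : 2 * (N + 1) = 2 * N + 1 + 1 := by ring
      rw [e1, e2, e3, e4, e5, qShifted_succ, qShifted_succ, r1, r2, r3, r4]
      push_cast
      generalize recipShifted (q ^ 2) (N + 1 + j) = s
      generalize recipShifted (q ^ 2) (N + 1 - j) = u
      generalize qShifted (q ^ 2) (q ^ 2) (2 * N) = Q
      have hl' : ∀ A B : ℝ, A * thetaTerm q t (j - 1) * (B * q ^ (2 * t))
          = A * B * (-(thetaTerm q t j / (q ^ 2) ^ j)) := fun A B => by rw [← tl]; ring
      have hr' : ∀ A B : ℝ, A * thetaTerm q t (j + 1) * (B / q ^ (2 * t))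
          = A * B * (-(thetaTerm q t j * (q ^ 2) ^ (j + 1))) := fun A B => by rw [← tr]; ring
      rw [hl', hr']
      generalize thetaTerm q t j = T
      have hpne := hp0.ne'
      simp only [zpow_add₀ hpne, zpow_sub₀ hpne, zpow_natCast, zpow_one]
      have hX : (q ^ 2) ^ j ≠ 0 := (zpow_pos hp0 _).ne'
      generalize (q ^ 2) ^ j = X at *
      generalize q ^ 2 = p at *
      have hY : p ^ (2 * N) = (p ^ N) ^ 2 := by rw [mul_comm, pow_mul]
      have hY1 : p ^ (2 * N + 1) = (p ^ N) ^ 2 * p := by rw [pow_succ, hY]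
      rw [hY, hY1, pow_succ p N]
      generalize p ^ N = Y
      field_simp
      ring
    · rw [tripleProd, Finset.prod_range_succ,
        show ∏ k ∈ Finset.range N, _ = tripleProd q t N from rfl]
      have hY1 : (q ^ 2) ^ (2 * N + 1) = ((q ^ 2) ^ N) ^ 2 * q ^ 2 := by
        rw [pow_succ, mul_comm 2, pow_mul]
      rw [hY1, pow_succ]
      field_simp
      ring

/-- The Jacobi triple product, as a limit of partial products. -/
lemma tendsto_tripleProd (hq1 : q < 1) {t : ℝ} (ht : t ∈ Set.Icc (-1) 2) :
    Tendsto (tripleProd q t) atTop (𝓝 (theta q t / qShiftedInf (q ^ 2) (q ^ 2))) := by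
  have hp0 : 0 < q ^ 2 := by positivity
  have hp1 : q ^ 2 < 1 := pow_lt_one₀ hq0.le hq1 two_ne_zero
  have he := qShiftedInf_pos hp0.le hp1 hp0 hp1
  set e := qShiftedInf (q ^ 2) (q ^ 2) with he_def
  have hlim : theta q t / e = ∑' j : ℤ, e * (1 / e * (1 / e)) * thetaTerm q t j := by
    rw [tsum_mul_left, ← theta]
    field_simp
  rw [hlim]
  have hfun : tripleProd q t = fun N : ℕ => ∑' j : ℤ, qShifted (q ^ 2) (q ^ 2) (2 * N) *
      (recipShifted (q ^ 2) (N + j) * recipShifted (q ^ 2) (N - j)) * thetaTerm q t j :=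
    funext fun N => (hasSum_tripleProd hq0 hq1 t N).tsum_eq.symm
  rw [hfun]
  refine tendsto_tsum_of_dominated_convergence
    (bound := fun j => 1 * (1 / e * (1 / e)) * thetaBound q j)
    ((summable_thetaBound hq0 hq1).mul_left _) (fun j => ?_) (Eventually.of_forall fun N j => ?_)
  · have hN : Tendsto (fun N : ℕ => (N : ℤ)) atTop atTop := tendsto_natCast_atTop_atTop
    refine Tendsto.mul_const _ (((tendsto_qShifted _ _ hp0 hp1).comp
      (tendsto_id.const_mul_atTop' two_pos)).mul (((tendsto_recipShifted hp0 hp1).comp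
      (tendsto_atTop_add_const_right _ j hN)).mul ((tendsto_recipShifted hp0 hp1).comp
      (tendsto_atTop_add_const_right _ (-j) hN))))
  · have h1 := qShifted_pos hp0.le hp1 hp0 hp1 (2 * N)
    have h2 : qShifted (q ^ 2) (q ^ 2) (2 * N) ≤ 1 :=
      Finset.prod_le_one (fun i _ => (one_sub_mul_pow_pos hp0.le hp1 hp0 hp1 i).le) fun i _ => by
        have : 0 < q ^ 2 * (q ^ 2) ^ i := by positivity
        linarith
    have h3 := recipShifted_nonneg hp0 hp1
    have h4 := recipShifted_le hp0 hp1
    rw [Real.norm_eq_abs, abs_mul, abs_of_nonneg (mul_nonneg h1.le (mul_nonneg (h3 _) (h3 _)))]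
    refine mul_le_mul ?_ (abs_thetaTerm_le hq0 hq1 ht j) (abs_nonneg _) (by positivity)
    exact mul_le_mul h2 (mul_le_mul (h4 _) (h4 _) (h3 _) (by positivity))
      (mul_nonneg (h3 _) (h3 _)) zero_le_one

end

/-! ### The sign of the theta series -/

section
variable {q : ℝ} (hq0 : 0 < q) (hq1 : q < 1)
include hq0 hq1

lemma tripleProd_add_two_le {t : ℝ} (ht : t ∈ Set.Icc 0 1) (N : ℕ) :
    tripleProd q t (N + 2) ≤ -((q ^ (-(2 * t)) - 1) * (1 - q ^ (2 * (1 - t))) *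
      qShiftedInf (q ^ 2) (q ^ 2) ^ 2) := by
  have hp0 : 0 < q ^ 2 := by positivity
  have hp1 : q ^ 2 < 1 := pow_lt_one₀ hq0.le hq1 two_ne_zero
  have he := qShiftedInf_pos hp0.le hp1 hp0 hp1
  have hle := qShiftedInf_le_qShifted hp0.le hp1 hp0 hp1
  have hx : 0 < q ^ (2 * t) := Real.rpow_pos_of_pos hq0 _
  have hx1 : q ^ (2 * t) ≤ 1 := Real.rpow_le_one hq0.le hq1.le (by linarith [ht.1])
  have hxp : q ^ 2 / q ^ (2 * t) = q ^ (2 * (1 - t)) := by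
    rw [mul_sub, mul_one, Real.rpow_sub hq0, Real.rpow_two]
  have hxp1 : q ^ (2 * (1 - t)) ≤ 1 := Real.rpow_le_one hq0.le hq1.le (by linarith [ht.2])
  have hxi : 1 / q ^ (2 * t) = q ^ (-(2 * t)) := by rw [Real.rpow_neg hq0.le, one_div]
  have hxi1 : 1 ≤ q ^ (-(2 * t)) := by
    rw [← hxi]; exact one_le_one_div hx hx1
  have hA : qShifted (q ^ 2) (q ^ 2) (N + 2)
      ≤ ∏ k ∈ Finset.range (N + 2), (1 - (q ^ 2) ^ (k + 1) * q ^ (2 * t)) := by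
    refine Finset.prod_le_prod
      (fun k _ => (one_sub_mul_pow_pos hp0.le hp1 hp0 hp1 k).le) fun k _ => ?_
    rw [← pow_succ']
    have := mul_le_of_le_one_right (pow_pos hp0 (k + 1)).le hx1
    linarith
  have hB : qShifted (q ^ 2) (q ^ 2) N
      ≤ ∏ k ∈ Finset.range N, (1 - (q ^ 2) ^ (k + 1 + 1) / q ^ (2 * t)) := by
    refine Finset.prod_le_prod
      (fun k _ => (one_sub_mul_pow_pos hp0.le hp1 hp0 hp1 k).le) fun k _ => ?_
    rw [pow_succ _ (k + 1), mul_div_assoc, hxp, ← pow_succ']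
    have := mul_le_of_le_one_right (pow_pos hp0 (k + 1)).le hxp1
    linarith
  rw [tripleProd, Finset.prod_mul_distrib,
    Finset.prod_range_succ' (fun k => 1 - (q ^ 2) ^ k / q ^ (2 * t)),
    Finset.prod_range_succ' (fun k => 1 - (q ^ 2) ^ (k + 1) / q ^ (2 * t)),
    zero_add, pow_zero, pow_one, hxp, hxi]
  set A := ∏ k ∈ Finset.range (N + 2), (1 - (q ^ 2) ^ (k + 1) * q ^ (2 * t))
  set B := ∏ k ∈ Finset.range N, (1 - (q ^ 2) ^ (k + 1 + 1) / q ^ (2 * t))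
  have hAB : qShiftedInf (q ^ 2) (q ^ 2) ^ 2 ≤ A * B := by
    rw [sq]
    exact mul_le_mul ((hle _).trans hA) ((hle _).trans hB) he.le
      (he.le.trans ((hle _).trans hA))
  have := mul_le_mul_of_nonneg_left hAB
    (mul_nonneg (sub_nonneg.2 hxi1) (sub_nonneg.2 hxp1))
  linarith

/-- On `[0, 1]` the theta series is negative, vanishing at most to first order at the endpoints. -/
lemma exists_theta_le :
    ∃ c > 0, ∀ t ∈ Set.Icc (0 : ℝ) 1, theta q t ≤ -(c * (t * (1 - t))) := by
  have hp0 : 0 < q ^ 2 := by positivity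
  have hp1 : q ^ 2 < 1 := pow_lt_one₀ hq0.le hq1 two_ne_zero
  have he := qShiftedInf_pos hp0.le hp1 hp0 hp1
  obtain ⟨L, hL, hLq⟩ : ∃ L > 0, Real.log q = -L :=
    ⟨-Real.log q, neg_pos.2 (Real.log_neg hq0 hq1), by ring⟩
  set e := qShiftedInf (q ^ 2) (q ^ 2)
  refine ⟨e ^ 3 * (2 * L * (2 * L / (1 + 2 * L))), by positivity, fun t ht => ?_⟩
  have h1 : theta q t / e ≤ -((q ^ (-(2 * t)) - 1) * (1 - q ^ (2 * (1 - t))) * e ^ 2) := by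
    refine le_of_tendsto (tendsto_tripleProd hq0 hq1 ⟨by linarith [ht.1], by linarith [ht.2]⟩) ?_
    filter_upwards [eventually_ge_atTop 2] with N hN
    obtain ⟨M, rfl⟩ := Nat.exists_eq_add_of_le' hN
    exact tripleProd_add_two_le hq0 hq1 ht M
  have h2 : 2 * L * t ≤ q ^ (-(2 * t)) - 1 := by
    rw [Real.rpow_def_of_pos hq0, hLq]
    linarith [Real.add_one_le_exp (-L * -(2 * t))]
  -- `1 - e^(-y) ≥ y / (1 + y)` for `y = 2 L (1 - t) ≤ 2 L`
  have h3 : 2 * L / (1 + 2 * L) * (1 - t) ≤ 1 - q ^ (2 * (1 - t)) := by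
    have hy : 0 ≤ 2 * L * (1 - t) := mul_nonneg (by positivity) (by linarith [ht.2])
    have hexp := Real.add_one_le_exp (2 * L * (1 - t))
    have hb : Real.exp (-(2 * L * (1 - t))) ≤ 1 / (2 * L * (1 - t) + 1) := by
      rw [Real.exp_neg, ← one_div]
      exact one_div_le_one_div_of_le (by positivity) hexp
    rw [Real.rpow_def_of_pos hq0, hLq, show -L * (2 * (1 - t)) = -(2 * L * (1 - t)) by ring]
    refine le_trans ?_ (sub_le_sub_left hb 1)
    have hle : 2 * L * (1 - t) + 1 ≤ 1 + 2 * L := by nlinarith [ht.1]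
    rw [one_sub_div (by positivity), add_sub_cancel_right, div_mul_eq_mul_div]
    exact div_le_div_of_nonneg_left hy (by positivity) hle
  have h4 : 2 * L * t * (2 * L / (1 + 2 * L) * (1 - t))
      ≤ (q ^ (-(2 * t)) - 1) * (1 - q ^ (2 * (1 - t))) :=
    mul_le_mul h2 h3 (mul_nonneg (by positivity) (by linarith [ht.2]))
      (le_trans (mul_nonneg (by positivity) ht.1) h2)
  rw [div_le_iff₀ he] at h1
  have h5 := mul_le_mul_of_nonneg_right h4 (pow_pos he 3).le
  linarith

/-- At an integer point a factor of the triple product vanishes. -/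
lemma theta_eq_zero {t : ℝ} (n : ℕ) (ht : t ∈ Set.Icc (-1) 2) (htn : t = n) : theta q t = 0 := by
  have hp0 : 0 < q ^ 2 := by positivity
  have hp1 : q ^ 2 < 1 := pow_lt_one₀ hq0.le hq1 two_ne_zero
  have he := qShiftedInf_pos hp0.le hp1 hp0 hp1
  have h : Tendsto (tripleProd q t) atTop (𝓝 0) := by
    refine tendsto_const_nhds.congr' ?_
    filter_upwards [eventually_gt_atTop n] with N hN
    refine (Finset.prod_eq_zero (Finset.mem_range.2 hN) ?_).symm
    rw [htn, Real.rpow_mul hq0.le, Real.rpow_two, Real.rpow_natCast,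
      div_self (pow_pos hp0 n).ne', sub_self, mul_zero]
  simpa [he.ne'] using tendsto_nhds_unique (tendsto_tripleProd hq0 hq1 ht) h

/-- The slope of the theta series at `0` is negative, so its first moment is positive. -/
lemma thetaMoment_zero_pos : 0 < thetaMoment q 0 := by
  obtain ⟨c, hc, hle⟩ := exists_theta_le hq0 hq1
  have hd := (hasDerivAt_theta hq0 hq1 (t := 0) (by norm_num)).tendsto_slope.mono_left
    (nhdsWithin_mono _ (s := Set.Ioi 0) fun x hx => (ne_of_gt hx : x ≠ 0))
  have h1 : Tendsto (fun t : ℝ => -(c * (1 - t))) (𝓝[>] 0) (𝓝 (-(c * (1 - 0)))) :=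
    (Continuous.tendsto (by fun_prop) 0).mono_left nhdsWithin_le_nhds
  have h2 : 2 * Real.log q * thetaMoment q 0 ≤ -(c * (1 - 0)) := by
    refine le_of_tendsto_of_tendsto hd h1 ?_
    filter_upwards [Ioc_mem_nhdsGT (show (0 : ℝ) < 1 by norm_num)] with t ht
    rw [slope_def_field, theta_eq_zero hq0 hq1 0 (by norm_num) (by norm_num : (0 : ℝ) = (0 : ℕ)),
      sub_zero, sub_zero, div_le_iff₀ ht.1]
    linarith [hle t ⟨ht.1.le, ht.2⟩]
  have := Real.log_neg hq0 hq1
  by_contra! h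
  nlinarith

/-- The slope of the theta series at `1` is positive, so its first moment is negative. -/
lemma thetaMoment_one_neg : thetaMoment q 1 < 0 := by
  obtain ⟨c, hc, hle⟩ := exists_theta_le hq0 hq1
  have hd := (hasDerivAt_theta hq0 hq1 (t := 1) (by norm_num)).tendsto_slope.mono_left
    (nhdsWithin_mono _ (s := Set.Iio 1) fun x hx => (ne_of_lt hx : x ≠ 1))
  have h1 : Tendsto (fun t : ℝ => c * t) (𝓝[<] 1) (𝓝 (c * 1)) :=
    (Continuous.tendsto (by fun_prop) 1).mono_left nhdsWithin_le_nhds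
  have h2 : c * 1 ≤ 2 * Real.log q * thetaMoment q 1 := by
    refine le_of_tendsto_of_tendsto h1 hd ?_
    filter_upwards [Ico_mem_nhdsLT (show (0 : ℝ) < 1 by norm_num)] with t ht
    rw [slope_def_field, theta_eq_zero hq0 hq1 1 (by norm_num) (by norm_num : (1 : ℝ) = (1 : ℕ)),
      sub_zero, le_div_iff_of_neg (by linarith [ht.2])]
    linarith [hle t ⟨ht.1, ht.2.le⟩]
  have := Real.log_neg hq0 hq1
  by_contra! h
  nlinarith

end

/-! ### The derivative of the Hahn–Exton function -/

lemma summable_one_add_mul_pow {q : ℝ} (hq0 : 0 < q) (hq1 : q < 1) {R : ℝ} (hR : 0 < R) :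
    Summable fun k : ℕ => (1 + (k : ℝ)) * (q ^ (k * (k + 1)) * R ^ (2 * k)) := by
  refine ((summable_one_add_abs_mul_rpow hq0 hq1 (-Real.logb q (q * R ^ 2))).comp_injective
    Nat.cast_injective).congr fun k => ?_
  have e : q ^ Real.logb q (q * R ^ 2) = q * R ^ 2 := Real.rpow_logb hq0 hq1.ne (by positivity)
  simp only [Function.comp_apply, Int.cast_natCast, Nat.abs_cast]
  rw [neg_mul, sub_neg_eq_add, Real.rpow_add hq0, Real.rpow_mul hq0.le, e, Real.rpow_natCast,
    mul_pow, ← pow_mul R, mul_add_one k, pow_add, ← Nat.cast_pow, Real.rpow_natCast, sq k,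
    mul_assoc (q ^ (k * k))]

section
variable {q ν : ℝ} (hq0 : 0 < q) (hq1 : q < 1) (hν : -1 < ν)
include hq0 hq1 hν

/-- Differentiation of the power series of `J_ν(z; q^2)` term by term. -/
lemma hasDerivAt_hahnExtonJ {z : ℝ} (hz : 0 < z) :
    HasDerivAt (fun z => hahnExtonJ ν (q ^ 2) z)
      (z ^ (ν - 1) * (qShiftedInf ((q ^ 2) ^ (ν + 1)) (q ^ 2) / qShiftedInf (q ^ 2) (q ^ 2)) *
        ∑' k : ℕ, (ν + 2 * k) * ((-1) ^ k * weight ((q ^ 2) ^ (ν + 1)) (q ^ 2) k *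
          (q ^ (k * (k + 1)) * z ^ (2 * k)))) z := by
  have hp0 : 0 < q ^ 2 := by positivity
  have hp1 : q ^ 2 < 1 := pow_lt_one₀ hq0.le hq1 two_ne_zero
  have ha0 : 0 ≤ (q ^ 2) ^ (ν + 1) := (Real.rpow_pos_of_pos hp0 _).le
  have ha1 : (q ^ 2) ^ (ν + 1) < 1 := Real.rpow_lt_one hp0.le hp1 (by linarith)
  have hw0 := weight_pos ha0 ha1 hp0 hp1
  have hw1 := weight_le_weightInf ha0 ha1 hp0 hp1
  have hwI := weightInf_pos ha0 ha1 hp0 hp1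
  have hJ : (fun z => hahnExtonJ ν (q ^ 2) z) = fun z =>
      z ^ ν * (qShiftedInf ((q ^ 2) ^ (ν + 1)) (q ^ 2) / qShiftedInf (q ^ 2) (q ^ 2)) *
        ∑' k : ℕ, (-1) ^ k * weight ((q ^ 2) ^ (ν + 1)) (q ^ 2) k * q ^ (k * (k + 1)) *
          z ^ (2 * k) := by
    funext z
    simp only [hahnExtonJ, weight]
    congr 1
    refine tsum_congr fun k => ?_
    rw [← pow_mul, Nat.mul_div_cancel' (Nat.even_mul_succ_self k).two_dvd]
    ring
  rw [hJ]
  set a := (q ^ 2) ^ (ν + 1)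
  set C := qShiftedInf a (q ^ 2) / qShiftedInf (q ^ 2) (q ^ 2)
  have hcoeff : ∀ k : ℕ, |(-1) ^ k * weight a (q ^ 2) k * q ^ (k * (k + 1))|
      ≤ weightInf a (q ^ 2) * q ^ (k * (k + 1)) := fun k => by
    rw [abs_mul, abs_mul, abs_neg_one_pow, one_mul, abs_of_pos (hw0 k),
      abs_of_pos (pow_pos hq0 _)]
    exact mul_le_mul_of_nonneg_right (hw1 k) (by positivity)
  have hs0 : Summable fun k : ℕ => (-1) ^ k * weight a (q ^ 2) k * q ^ (k * (k + 1)) *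
      z ^ (2 * k) := by
    refine ((summable_one_add_mul_pow hq0 hq1 hz).mul_left
      (weightInf a (q ^ 2))).of_norm_bounded fun k => ?_
    rw [Real.norm_eq_abs, abs_mul, abs_of_pos (pow_pos hz _)]
    refine (mul_le_mul_of_nonneg_right (hcoeff k) (by positivity)).trans ?_
    rw [mul_assoc]
    refine mul_le_mul_of_nonneg_left ?_ hwI.le
    exact le_mul_of_one_le_left (by positivity) (by linarith [(Nat.cast_nonneg k : (0 : ℝ) ≤ k)])
  have hbound : ∀ (k : ℕ) (y : ℝ), y ∈ Set.Ioo 0 (z + 1) →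
      ‖(-1) ^ k * weight a (q ^ 2) k * q ^ (k * (k + 1)) * (((2 * k : ℕ) : ℝ) * y ^ (2 * k - 1))‖
        ≤ 2 * weightInf a (q ^ 2) * ((1 + (k : ℝ)) * (q ^ (k * (k + 1)) * (z + 1) ^ (2 * k))) := by
    intro k y hy
    have hy1 : y ^ (2 * k - 1) ≤ (z + 1) ^ (2 * k) :=
      (pow_le_pow_left₀ hy.1.le hy.2.le _).trans
        (pow_le_pow_right₀ (by linarith) (Nat.sub_le _ _))
    have h2 : ((2 * k : ℕ) : ℝ) * y ^ (2 * k - 1) ≤ 2 * (1 + k) * (z + 1) ^ (2 * k) := by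
      refine mul_le_mul ?_ hy1 (pow_pos hy.1 _).le (by positivity)
      push_cast; linarith
    rw [Real.norm_eq_abs, abs_mul, abs_of_nonneg (mul_nonneg (Nat.cast_nonneg _)
      (pow_pos hy.1 (2 * k - 1)).le)]
    refine (mul_le_mul (hcoeff k) h2 (mul_nonneg (Nat.cast_nonneg _)
      (pow_pos hy.1 (2 * k - 1)).le) (by positivity)).trans (le_of_eq (by ring))
  have hmem : z ∈ Set.Ioo 0 (z + 1) := ⟨hz, by linarith⟩
  have hsum := (summable_one_add_mul_pow hq0 hq1 (show 0 < z + 1 by linarith)).mul_left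
    (2 * weightInf a (q ^ 2))
  have hS := hasDerivAt_tsum_of_isPreconnected hsum isOpen_Ioo isPreconnected_Ioo
    (g := fun (k : ℕ) (y : ℝ) => (-1) ^ k * weight a (q ^ 2) k * q ^ (k * (k + 1)) * y ^ (2 * k))
    (fun k y _ => (hasDerivAt_pow (2 * k) y).const_mul _) hbound hmem hs0 hmem
  have hs1 : Summable fun k : ℕ => (-1) ^ k * weight a (q ^ 2) k * q ^ (k * (k + 1)) *
      (((2 * k : ℕ) : ℝ) * z ^ (2 * k - 1)) := hsum.of_norm_bounded fun k => hbound k z hmem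
  have hpow : HasDerivAt (fun y : ℝ => y ^ ν) (ν * z ^ (ν - 1)) z :=
    Real.hasDerivAt_rpow_const (Or.inl hz.ne')
  refine ((hpow.mul_const C).mul hS).congr_deriv ?_
  have hzν : z ^ ν = z ^ (ν - 1) * z := by
    rw [Real.rpow_sub_one hz.ne', div_mul_cancel₀ _ hz.ne']
  have htot : ∑' k : ℕ, (ν + 2 * k) * ((-1) ^ k * weight a (q ^ 2) k *
      (q ^ (k * (k + 1)) * z ^ (2 * k)))
      = ν * (∑' k : ℕ, (-1) ^ k * weight a (q ^ 2) k * q ^ (k * (k + 1)) * z ^ (2 * k))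
        + z * ∑' k : ℕ, (-1) ^ k * weight a (q ^ 2) k * q ^ (k * (k + 1)) *
          (((2 * k : ℕ) : ℝ) * z ^ (2 * k - 1)) := by
    rw [← tsum_mul_left, ← tsum_mul_left, ← (hs0.mul_left ν).tsum_add (hs1.mul_left z)]
    refine tsum_congr fun k => ?_
    rcases Nat.eq_zero_or_pos k with rfl | hk
    · simp
    · have : z ^ (2 * k) = z * z ^ (2 * k - 1) := (mul_pow_sub_one (by lia) z).symm
      rw [this]
      push_cast
      ring
  rw [htot, hzν]
  ring

end

/-! ### Reindexing around the dominant terms -/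

/-- The weight `1 / ((a; p)_k (p; p)_k)` extended by `0` to negative integers `k`. -/
noncomputable def intWeight (a p : ℝ) (k : ℤ) : ℝ := if 0 ≤ k then weight a p k.toNat else 0

lemma abs_intWeight_sub_weightInf_le {a p : ℝ} (ha0 : 0 ≤ a) (ha1 : a < 1) (hp0 : 0 < p)
    (hp1 : p < 1) (k : ℤ) :
    |intWeight a p k - weightInf a p| ≤ 2 * weightInf a p / (1 - p) * p ^ k := by
  have hw := weightInf_pos ha0 ha1 hp0 hp1
  have h1p : 0 < 1 - p := by linarith
  unfold intWeight
  split_ifs with hk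
  · obtain ⟨n, rfl⟩ := Int.eq_ofNat_of_zero_le hk
    refine (abs_weight_sub_weightInf_le ha0 ha1 hp0 hp1 n).trans (le_of_eq ?_)
    rw [zpow_natCast]
    ring
  · have h1 : 1 ≤ p ^ k := one_le_zpow_of_nonpos₀ hp0 hp1.le (by lia)
    have h2 : weightInf a p ≤ 2 * weightInf a p / (1 - p) := by
      rw [le_div_iff₀ h1p]; nlinarith
    rw [zero_sub, abs_neg, abs_of_pos hw]
    exact h2.trans (le_mul_of_one_le_right (hw.le.trans h2) h1)

/-- The normalised series for `J_ν'` at `z = q^(-m+t)`: the power series summed over the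
distance `j` of the summation index from `m`. -/
noncomputable def centredSum (ν q t : ℝ) (m : ℕ) : ℝ :=
  ∑' j : ℤ, (ν + 2 * m + 2 * j) * intWeight ((q ^ 2) ^ (ν + 1)) (q ^ 2) (m + j) * thetaTerm q t j

section
variable {q ν : ℝ} (hq0 : 0 < q) (hq1 : q < 1) (hν : -1 < ν)
include hq0

lemma tsum_eq_centredSum (t : ℝ) (m : ℕ) :
    ∑' k : ℕ, (ν + 2 * k) * ((-1) ^ k * weight ((q ^ 2) ^ (ν + 1)) (q ^ 2) k *
        (q ^ (k * (k + 1)) * (q ^ (-(m : ℝ) + t)) ^ (2 * k)))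
      = (-1) ^ m * q ^ (-(m : ℝ) ^ 2 + m + 2 * t * m) * centredSum ν q t m := by
  have hinj : Function.Injective fun k : ℕ => (k : ℤ) - m := fun k l h => by
    simpa using h
  rw [centredSum, ← hinj.tsum_eq, ← tsum_mul_left]
  · refine tsum_congr fun k => ?_
    have e1 : ((m : ℤ) + ((k : ℤ) - m)) = k := by ring
    have e2 : (-1 : ℝ) ^ k = (-1) ^ m * (-1) ^ ((k : ℤ) - m) := by
      rw [← zpow_natCast, ← zpow_natCast, ← zpow_add₀ (by norm_num), e1]
    have e3 : q ^ (k * (k + 1)) * (q ^ (-(m : ℝ) + t)) ^ (2 * k)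
        = q ^ (-(m : ℝ) ^ 2 + m + 2 * t * m)
          * q ^ ((((k : ℤ) - m : ℤ) : ℝ) * (((k : ℤ) - m : ℤ) + 1)
            + 2 * t * (((k : ℤ) - m : ℤ) : ℝ)) := by
      rw [← Real.rpow_natCast, ← Real.rpow_natCast, ← Real.rpow_mul hq0.le, ← Real.rpow_add hq0,
        ← Real.rpow_add hq0]
      congr 1
      push_cast
      ring
    rw [e1, e2, e3, thetaTerm, intWeight, if_pos (Int.natCast_nonneg k), Int.toNat_natCast]
    push_cast
    ring
  · intro j hj
    refine ⟨(m + j).toNat, ?_⟩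
    have : 0 ≤ (m : ℤ) + j := by
      by_contra h
      simp [intWeight, h] at hj
    simp only
    lia

include hq1 hν

/-- The weights near the dominant index may be replaced by their limit, with an error that is
exponentially small in `m`, uniformly in `t`. -/
lemma exists_abs_centredSum_sub_le :
    ∃ K, ∀ (m : ℕ), ∀ t ∈ Set.Icc (0 : ℝ) 1,
      |centredSum ν q t m - weightInf ((q ^ 2) ^ (ν + 1)) (q ^ 2) *
        ((2 * m + ν) * theta q t + 2 * thetaMoment q t)| ≤ K * ((m + 1) * (q ^ 2) ^ m) := by
  have hp0 : 0 < q ^ 2 := by positivity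
  have hp1 : q ^ 2 < 1 := pow_lt_one₀ hq0.le hq1 two_ne_zero
  have ha0 : 0 ≤ (q ^ 2) ^ (ν + 1) := (Real.rpow_pos_of_pos hp0 _).le
  have ha1 : (q ^ 2) ^ (ν + 1) < 1 := Real.rpow_lt_one hp0.le hp1 (by linarith)
  have hwI := weightInf_pos ha0 ha1 hp0 hp1
  have hdiff := abs_intWeight_sub_weightInf_le ha0 ha1 hp0 hp1
  unfold centredSum
  set a := (q ^ 2) ^ (ν + 1)
  set w := weightInf a (q ^ 2)
  set D := 2 * w / (1 - q ^ 2)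
  have hD : 0 < D := div_pos (by positivity) (by linarith)
  refine ⟨(|ν| + 2) * D * ∑' j, thetaBound q j, fun m t ht => ?_⟩
  have ht' : t ∈ Set.Icc (-1 : ℝ) 2 := ⟨by linarith [ht.1], by linarith [ht.2]⟩
  have hmain : HasSum (fun j : ℤ => w * ((2 * m + ν) * thetaTerm q t j
      + 2 * (j * thetaTerm q t j))) (w * ((2 * m + ν) * theta q t + 2 * thetaMoment q t)) :=
    (((summable_thetaTerm hq0 hq1 ht').hasSum.mul_left _).add
      ((summable_mul_thetaTerm hq0 hq1 ht').hasSum.mul_left _)).mul_left _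
  have hbd : ∀ j : ℤ, ‖(ν + 2 * m + 2 * j) * (intWeight a (q ^ 2) (m + j) - w) * thetaTerm q t j‖
      ≤ (|ν| + 2) * D * ((m + 1) * (q ^ 2) ^ m) * thetaBound q j := fun j => by
    have h1 : |ν + 2 * m + 2 * j| ≤ (|ν| + 2) * (m + 1) * (1 + |(j : ℝ)|) := by
      have hm : (0 : ℝ) ≤ m := Nat.cast_nonneg m
      have hj := abs_nonneg (j : ℝ)
      have hn := abs_nonneg ν
      have h3 : |ν + 2 * m + 2 * j| ≤ |ν| + 2 * m + 2 * |(j : ℝ)| := by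
        refine (abs_add_three _ _ _).trans (le_of_eq ?_)
        rw [abs_mul, abs_mul, abs_two, Nat.abs_cast]
      nlinarith [mul_nonneg hm hj, mul_nonneg hn hm, mul_nonneg hn hj,
        mul_nonneg hn (mul_nonneg hm hj)]
    have h2 : |intWeight a (q ^ 2) (m + j) - w| * |thetaTerm q t j|
        ≤ D * (q ^ 2) ^ m * q ^ ((j : ℝ) ^ 2 + (3 + 2 * t) * j) := by
      refine (mul_le_mul_of_nonneg_right (hdiff (m + j)) (abs_nonneg _)).trans (le_of_eq ?_)
      have e : (q ^ 2) ^ j = q ^ (2 * (j : ℝ)) := by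
        rw [Real.rpow_mul hq0.le, Real.rpow_intCast]; norm_cast
      rw [abs_thetaTerm hq0, zpow_add₀ hp0.ne', zpow_natCast, e, mul_assoc D, mul_assoc D,
        mul_assoc ((q ^ 2) ^ m), ← Real.rpow_add hq0]
      congr 3
      ring
    have h4 := rpow_le_thetaBound hq0 hq1 (c := 3 + 2 * t)
      (abs_le.2 ⟨by linarith [ht.1], by linarith [ht.2]⟩) j
    rw [Real.norm_eq_abs, abs_mul, abs_mul, mul_assoc]
    calc _ ≤ (|ν| + 2) * (m + 1) * (1 + |(j : ℝ)|)
          * (D * (q ^ 2) ^ m * q ^ ((j : ℝ) ^ 2 + (3 + 2 * t) * j)) :=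
          mul_le_mul h1 h2 (by positivity) (by positivity)
      _ = (|ν| + 2) * D * ((m + 1) * (q ^ 2) ^ m)
          * ((1 + |(j : ℝ)|) * q ^ ((j : ℝ) ^ 2 + (3 + 2 * t) * j)) := by ring
      _ ≤ _ := mul_le_mul_of_nonneg_left h4 (by positivity)
  have hsb := (summable_thetaBound hq0 hq1).mul_left ((|ν| + 2) * D * ((m + 1) * (q ^ 2) ^ m))
  have herr := (hsb.of_norm_bounded hbd).hasSum
  have heq : (∑' j : ℤ, (ν + 2 * m + 2 * j) * intWeight a (q ^ 2) (m + j) * thetaTerm q t j)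
      = w * ((2 * m + ν) * theta q t + 2 * thetaMoment q t)
        + ∑' j : ℤ, (ν + 2 * m + 2 * j) * (intWeight a (q ^ 2) (m + j) - w) * thetaTerm q t j := by
    rw [← (hmain.add herr).tsum_eq]
    exact tsum_congr fun j => by ring
  rw [heq, add_sub_cancel_left]
  refine (tsum_of_norm_bounded hsb.hasSum hbd).trans (le_of_eq ?_)
  rw [tsum_mul_left]
  ring

/-- At `z = q^(-m+t)`, the derivative of `J_ν(z; q^2)` has the sign of `(-1)^m` times the
centred sum. -/
lemma sign_deriv_hahnExtonJ (t : ℝ) (m : ℕ) :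
    Real.sign (deriv (fun z : ℝ => hahnExtonJ ν (q ^ 2) z) (q ^ (-(m : ℝ) + t)))
      = Real.sign ((-1) ^ m * centredSum ν q t m) := by
  have hp0 : 0 < q ^ 2 := by positivity
  have hp1 : q ^ 2 < 1 := pow_lt_one₀ hq0.le hq1 two_ne_zero
  have ha0 : 0 ≤ (q ^ 2) ^ (ν + 1) := (Real.rpow_pos_of_pos hp0 _).le
  have ha1 : (q ^ 2) ^ (ν + 1) < 1 := Real.rpow_lt_one hp0.le hp1 (by linarith)
  have h1 := qShiftedInf_pos ha0 ha1 hp0 hp1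
  have h2 := qShiftedInf_pos hp0.le hp1 hp0 hp1
  have hz : 0 < q ^ (-(m : ℝ) + t) := Real.rpow_pos_of_pos hq0 _
  have h3 : 0 < (q ^ (-(m : ℝ) + t)) ^ (ν - 1) := Real.rpow_pos_of_pos hz _
  have h4 : 0 < q ^ (-(m : ℝ) ^ 2 + m + 2 * t * m) := Real.rpow_pos_of_pos hq0 _
  rw [(hasDerivAt_hahnExtonJ hq0 hq1 hν hz).deriv, tsum_eq_centredSum hq0]
  set A := (q ^ (-(m : ℝ) + t)) ^ (ν - 1) *
    (qShiftedInf ((q ^ 2) ^ (ν + 1)) (q ^ 2) / qShiftedInf (q ^ 2) (q ^ 2))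
  have hA : 0 < A := mul_pos h3 (div_pos h1 h2)
  have hB := mul_pos hA h4
  rw [show ∀ x y z w : ℝ, x * (y * z * w) = x * z * (y * w) by intros; ring]
  generalize A * q ^ (-(m : ℝ) ^ 2 + m + 2 * t * m) = B at hB
  generalize (-1) ^ m * centredSum ν q t m = x
  rcases lt_trichotomy x 0 with h | h | h
  · rw [Real.sign_of_neg h, Real.sign_of_neg (mul_neg_of_pos_of_neg hB h)]
  · rw [h, mul_zero]
  · rw [Real.sign_of_pos h, Real.sign_of_pos (mul_pos hB h)]

end

lemma sign_neg_one_pow_mul_of_pos (m : ℕ) {x : ℝ} (hx : 0 < x) :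
    Real.sign ((-1) ^ m * x) = (-1) ^ m := by
  rcases neg_one_pow_eq_or ℝ m with h | h
  · rw [h, one_mul, Real.sign_of_pos hx]
  · rw [h, neg_one_mul, Real.sign_of_neg (neg_lt_zero.2 hx)]

/-! ### Asymptotic signs -/

section
variable {q ν : ℝ} (hq0 : 0 < q) (hq1 : q < 1) (hν : -1 < ν) {θ : ℕ → ℝ}
  (hθ : ∀ m : ℕ, 1 ≤ m → 0 ≤ θ m ∧ θ m < 1)
include hq0 hq1 hν hθ

lemma tendsto_centredSum_sub :
    Tendsto (fun m : ℕ => centredSum ν q (θ m) m - weightInf ((q ^ 2) ^ (ν + 1)) (q ^ 2) *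
      ((2 * m + ν) * theta q (θ m) + 2 * thetaMoment q (θ m))) atTop (𝓝 0) := by
  have hp0 : 0 ≤ q ^ 2 := by positivity
  have hp1 : q ^ 2 < 1 := pow_lt_one₀ hq0.le hq1 two_ne_zero
  obtain ⟨K, hK⟩ := exists_abs_centredSum_sub_le hq0 hq1 hν
  have h : Tendsto (fun m : ℕ => K * (((m : ℝ) + 1) * (q ^ 2) ^ m)) atTop (𝓝 0) := by
    have := ((tendsto_self_mul_const_pow_of_lt_one hp0 hp1).add
      (tendsto_pow_atTop_nhds_zero_of_lt_one hp0 hp1)).const_mul K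
    rw [add_zero, mul_zero] at this
    exact this.congr fun m => by ring
  refine squeeze_zero_norm' ?_ h
  filter_upwards [eventually_ge_atTop 1] with m hm
  exact hK m _ ⟨(hθ m hm).1, (hθ m hm).2.le⟩

/-- If `m θ_m → 0`, the theta series contributes nothing in the limit and the first moment at `0`
decides the sign. -/
lemma eventually_centredSum_pos (h : Tendsto (fun m : ℕ => (m : ℝ) * θ m) atTop (𝓝 0)) :
    ∀ᶠ m : ℕ in atTop, 0 < centredSum ν q (θ m) m := by
  have hp0 : 0 < q ^ 2 := by positivity
  have hp1 : q ^ 2 < 1 := pow_lt_one₀ hq0.le hq1 two_ne_zero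
  have ha0 : 0 ≤ (q ^ 2) ^ (ν + 1) := (Real.rpow_pos_of_pos hp0 _).le
  have ha1 : (q ^ 2) ^ (ν + 1) < 1 := Real.rpow_lt_one hp0.le hp1 (by linarith)
  have hwI := weightInf_pos ha0 ha1 hp0 hp1
  have hM := thetaMoment_zero_pos hq0 hq1
  have hθ0 : Tendsto θ atTop (𝓝 0) := by
    refine squeeze_zero' ?_ ?_ h
    · filter_upwards [eventually_ge_atTop 1] with m hm using (hθ m hm).1
    · filter_upwards [eventually_ge_atTop 1] with m hm
      exact le_mul_of_one_le_left (hθ m hm).1 (by exact_mod_cast hm)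
  have h1 : Tendsto (fun m => thetaMoment q (θ m)) atTop (𝓝 (thetaMoment q 0)) :=
    ((continuousOn_thetaMoment hq0 hq1).continuousAt
      (Icc_mem_nhds (by norm_num) (by norm_num))).tendsto.comp hθ0
  have h2 : Tendsto (fun m : ℕ => (2 * (m : ℝ) + ν) * theta q (θ m)) atTop (𝓝 0) := by
    have hO : (fun t => theta q t) =O[𝓝 0] fun t => t := by
      have := (hasDerivAt_theta hq0 hq1 (t := 0) (by norm_num)).differentiableAt.isBigO_sub
      simpa [theta_eq_zero hq0 hq1 0 (by norm_num) (by norm_num : (0 : ℝ) = (0 : ℕ))] using this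
    refine ((Asymptotics.isBigO_refl (fun m : ℕ => 2 * (m : ℝ) + ν) atTop).mul
      (hO.comp_tendsto hθ0)).trans_tendsto ?_
    have := (h.const_mul 2).add (hθ0.const_mul ν)
    rw [mul_zero, mul_zero, add_zero] at this
    exact this.congr fun m => by simp only [Function.comp_apply]; ring
  have h3 := (tendsto_centredSum_sub hq0 hq1 hν hθ).add
    ((h2.add (h1.const_mul 2)).const_mul (weightInf ((q ^ 2) ^ (ν + 1)) (q ^ 2)))
  simp only [sub_add_cancel] at h3
  exact h3.eventually (lt_mem_nhds (by rw [zero_add, zero_add]; positivity))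

/-- If `m θ_m → ∞`, then away from `t = 1` the negative term `2 m theta` outweighs the bounded first
moment, and near `t = 1`, where the theta series may be arbitrarily small, the first moment is
itself negative. -/
lemma eventually_centredSum_neg (h : Tendsto (fun m : ℕ => (m : ℝ) * θ m) atTop atTop) :
    ∀ᶠ m : ℕ in atTop, centredSum ν q (θ m) m < 0 := by
  have hp0 : 0 < q ^ 2 := by positivity
  have hp1 : q ^ 2 < 1 := pow_lt_one₀ hq0.le hq1 two_ne_zero
  have ha0 : 0 ≤ (q ^ 2) ^ (ν + 1) := (Real.rpow_pos_of_pos hp0 _).le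
  have ha1 : (q ^ 2) ^ (ν + 1) < 1 := Real.rpow_lt_one hp0.le hp1 (by linarith)
  have hwI := weightInf_pos ha0 ha1 hp0 hp1
  have hM := thetaMoment_one_neg hq0 hq1
  obtain ⟨c, hc, hle⟩ := exists_theta_le hq0 hq1
  obtain ⟨B, hB⟩ := isCompact_Icc.exists_bound_of_continuousOn (continuousOn_thetaMoment hq0 hq1)
  have hev : ∀ᶠ t in 𝓝 (1 : ℝ), thetaMoment q t < thetaMoment q 1 / 2 :=
    ((continuousOn_thetaMoment hq0 hq1).continuousAt
      (Icc_mem_nhds (by norm_num) (by norm_num))).tendsto.eventually (gt_mem_nhds (by linarith))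
  obtain ⟨δ, hδ, hδM⟩ := Metric.eventually_nhds_iff.1 hev
  have herr := (tendsto_centredSum_sub hq0 hq1 hν hθ).eventually
    (gt_mem_nhds (show 0 < weightInf ((q ^ 2) ^ (ν + 1)) (q ^ 2) * -thetaMoment q 1 from
      mul_pos hwI (by linarith)))
  filter_upwards [herr, eventually_ge_atTop 1,
    h.eventually_ge_atTop ((2 * B - thetaMoment q 1) / (c * δ))] with m hm hm1 hmθ
  obtain ⟨ht0, ht1⟩ := hθ m hm1
  have hm1' : (1 : ℝ) ≤ m := by exact_mod_cast hm1
  have hθle := hle (θ m) ⟨ht0, ht1.le⟩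
  have hprod : 0 ≤ θ m * (1 - θ m) := mul_nonneg ht0 (by linarith)
  -- since `ν > -1` and `m ≥ 1`, the factor `2 m + ν` is at least `m`
  have hlead : (2 * m + ν) * theta q (θ m) ≤ m * -(c * (θ m * (1 - θ m))) :=
    (mul_le_mul_of_nonneg_left hθle (by linarith)).trans
      (mul_le_mul_of_nonpos_right (by linarith) (neg_nonpos.2 (by positivity)))
  have key : (2 * m + ν) * theta q (θ m) + 2 * thetaMoment q (θ m) ≤ thetaMoment q 1 := by
    rcases lt_or_ge (1 - θ m) δ with hd | hd
    · have h1 := hδM (y := θ m) (by rw [Real.dist_eq, abs_lt]; constructor <;> linarith)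
      have h2 : (0 : ℝ) ≤ m * (c * (θ m * (1 - θ m))) := by positivity
      linarith
    · have h1 := (le_abs_self _).trans (hB (θ m) ⟨by linarith, by linarith⟩)
      rw [div_le_iff₀ (by positivity)] at hmθ
      have h2 : (m : ℝ) * θ m * (c * δ) ≤ m * θ m * (c * (1 - θ m)) := by gcongr
      linarith
  have := mul_le_mul_of_nonneg_left key hwI.le
  linarith

end
end HahnExton

open HahnExton in
theorem theorem3p1 (q ν : ℝ) (hq0 : 0 < q) (hq1 : q < 1) (hν : -1 < ν)
    (θ : ℕ → ℝ) (hθ : ∀ m : ℕ, 1 ≤ m → 0 ≤ θ m ∧ θ m < 1) :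
    (Tendsto (fun m : ℕ => (m : ℝ) * θ m) atTop (𝓝 0) →
      ∀ᶠ m : ℕ in atTop,
        Real.sign (deriv (fun z : ℝ => hahnExtonJ ν (q ^ 2) z) (q ^ (-(m : ℝ) + θ m)))
          = (-1) ^ m) ∧
    (Tendsto (fun m : ℕ => (m : ℝ) * θ m) atTop atTop →
      ∀ᶠ m : ℕ in atTop,
        Real.sign (deriv (fun z : ℝ => hahnExtonJ ν (q ^ 2) z) (q ^ (-(m : ℝ) + θ m)))
          = (-1) ^ ((m : ℤ) - 1)) := by
  refine ⟨fun h => ?_, fun h => ?_⟩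
  · filter_upwards [eventually_centredSum_pos hq0 hq1 hν hθ h] with m hm
    rw [sign_deriv_hahnExtonJ hq0 hq1 hν, sign_neg_one_pow_mul_of_pos m hm]
  · filter_upwards [eventually_centredSum_neg hq0 hq1 hν hθ h] with m hm
    rw [sign_deriv_hahnExtonJ hq0 hq1 hν, ← neg_neg (centredSum ν q (θ m) m), mul_neg,
      ← neg_one_mul, ← mul_assoc, ← pow_succ', sign_neg_one_pow_mul_of_pos _ (neg_pos.2 hm),
      zpow_sub_one₀ (by norm_num), zpow_natCast, pow_succ, inv_neg_one]
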